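/- Let $\Bbbk$ be an infinite field of arbitrary characteristic, let $\mathcal{P}=\Bbbk[x_1,\dots,x_n]$, let $\prec$ be a term order on $\mathcal{P}$ with $x_1\prec x_2\prec\cdots\prec x_n$, and let $0\neq\mathcal{I}\lhd\mathcal{P}$ be a proper homogeneous ideal. For a non-singular matrix $A=(a_{ij})\in\Bbbk^{n\times n}$ let $A\cdot\mathcal{I}$ be the ideal obtained from $\mathcal{I}$ by the substitution $x_i\mapsto\sum_j a_{ij}x_j$. The generic initial ideal $\mathrm{gin}(\mathcal{I})$ is the ideal that equals the leading ideal $\mathrm{lt}(A\cdot\mathcal{I})$ with respect to $\prec$ for almost all $A$, i.e. for all $A$ in a non-empty Zariski open subset of $\mathrm{GL}_n(\Bbbk)$. The class of a term $x^\mu\neq1$ is $\mathrm{cls}(\mu)=\min\{i\mid\mu_i\neq0\}$, and $\mathrm{cls}(0)=n$. A finite set $\mathcal{H}$ of terms is a Pommaret basis of the monomial ideal $\mathcal{J}=\langle\mathcal{H}\rangle$ if $\mathcal{J}=\bigoplus_{x^\mu\in\mathcal{H}}\Bbbk[x_1,\dots,x_{\mathrm{cls}(\mu)}]\cdot x^\mu$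 as a $\Bbbk$-linear space; a monomial ideal is quasi-stable if it possesses a finite Pommaret basis. A finite set of non-zero homogeneous elements of a homogeneous ideal $\mathcal{K}$ is a Pommaret basis of $\mathcal{K}$ for $\prec$ if its elements have pairwise distinct leading terms and these terms form a Pommaret basis of $\mathrm{lt}(\mathcal{K})$; the variables are $\delta$-regular for $\mathcal{K}$ and $\prec$ if $\mathcal{K}$ has a finite Pommaret basis for $\prec$. Then the generic initial ideal $\mathrm{gin}(\mathcal{I})$ exists, is unique, and is quasi-stable. Moreover, generic variables are $\delta$-regular: for almost all $A$ the ideal $A\cdot\mathcal{I}$ has a finite Pommaret basis for $\prec$. -/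

import Mathlib

open MvPolynomial
open scoped MonomialOrder

attribute [local instance] MvPolynomial.gradedAlgebra

noncomputable section

namespace QuasiStable

variable {k : Type*} [Field k] {n : ℕ}

/-- The multiplicative variables of the term `x ^ μ`: the variables `x i` with `i ≤ cls μ`,
where the class `cls μ` is the least index of a variable occurring in `x ^ μ`. For `μ = 0`
all variables are multiplicative (the usual convention `cls 0 = n`). -/
def multVars (μ : Fin n →₀ ℕ) : Set (Fin n) :=
  {i | ∀ j ∈ μ.support, i ≤ j}

variable (k) in
/-- The `k`-linear space `k[multiplicative variables of x ^ μ] · x ^ μ`. -/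
def pommaretCone (μ : Fin n →₀ ℕ) : Submodule k (MvPolynomial (Fin n) k) :=
  (Subalgebra.toSubmodule (supported k (multVars μ))).map
    (LinearMap.mulRight k (monomial μ (1 : k)))

/-- The finite set `H` of terms (given by their exponents) is a Pommaret basis of the ideal `J`:
`H` generates `J`, and `J` is, as a `k`-linear space, the direct sum of the cones of the
elements of `H`. -/
def IsMonomialPommaretBasis (J : Ideal (MvPolynomial (Fin n) k)) (H : Finset (Fin n →₀ ℕ)) :
    Prop :=
  J = Ideal.span ((fun μ => monomial μ (1 : k)) '' (H : Set (Fin n →₀ ℕ))) ∧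
  iSupIndep (fun μ : H => pommaretCone k (μ : Fin n →₀ ℕ)) ∧
  (⨆ μ : H, pommaretCone k (μ : Fin n →₀ ℕ)) = J.restrictScalars k

/-- A quasi-stable ideal: a (necessarily monomial) ideal possessing a finite Pommaret basis
consisting of terms. -/
def IsQuasiStable (J : Ideal (MvPolynomial (Fin n) k)) : Prop :=
  ∃ H : Finset (Fin n →₀ ℕ), IsMonomialPommaretBasis J H

/-- The leading ideal of `I` for the term order `m`. -/
def leadingIdeal (m : MonomialOrder (Fin n)) (I : Ideal (MvPolynomial (Fin n) k)) :
    Ideal (MvPolynomial (Fin n) k) :=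
  Ideal.span (m.leadingTerm '' (I : Set (MvPolynomial (Fin n) k)))

/-- The finite set `H` is a (homogeneous) Pommaret basis of the homogeneous ideal `I` for the
term order `m`: its elements are non-zero homogeneous elements of `I` with pairwise distinct
leading terms, and these leading terms form a Pommaret basis of the leading ideal of `I`. -/
def IsPommaretBasis (m : MonomialOrder (Fin n)) (I : Ideal (MvPolynomial (Fin n) k))
    (H : Finset (MvPolynomial (Fin n) k)) : Prop :=
  (∀ h ∈ H, h ∈ I ∧ h ≠ 0 ∧ ∃ d : ℕ, h.IsHomogeneous d) ∧
  Set.InjOn m.degree (H : Set (MvPolynomial (Fin n) k)) ∧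
  IsMonomialPommaretBasis (leadingIdeal m I) (H.image m.degree)

/-- The variables are `δ`-regular for the homogeneous ideal `I` and the order `m`. -/
def IsDeltaRegular (m : MonomialOrder (Fin n)) (I : Ideal (MvPolynomial (Fin n) k)) : Prop :=
  ∃ H : Finset (MvPolynomial (Fin n) k), IsPommaretBasis m I H

/-- The linear substitution `x i ↦ ∑ j, A i j * x j`. -/
def linearSubst (A : Matrix (Fin n) (Fin n) k) :
    MvPolynomial (Fin n) k →ₐ[k] MvPolynomial (Fin n) k :=
  aeval (fun i => ∑ j, C (A i j) * X j)

/-- The ideal obtained from `I` by the linear change of variables `x i ↦ ∑ j, A i j * x j`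
(used for non-singular `A` only). -/
def changeVars (A : Matrix (Fin n) (Fin n) k) (I : Ideal (MvPolynomial (Fin n) k)) :
    Ideal (MvPolynomial (Fin n) k) :=
  I.map (linearSubst A)

/-- `P A` holds for almost all non-singular matrices `A`, that is, on a non-empty Zariski open
subset of the general linear group over the (infinite) field `k`. -/
def ForAlmostAll (P : Matrix (Fin n) (Fin n) k → Prop) : Prop :=
  ∃ p : MvPolynomial (Fin n × Fin n) k, p ≠ 0 ∧
    ∀ A : Matrix (Fin n) (Fin n) k, A.det ≠ 0 →
      eval (fun ij : Fin n × Fin n => A ij.1 ij.2) p ≠ 0 → P A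

/-- `J` is the generic initial ideal of `I` for the order `m`: it is the leading ideal of `I`
after almost all linear changes of variables. -/
def IsGenericInitialIdeal (m : MonomialOrder (Fin n)) (I J : Ideal (MvPolynomial (Fin n) k)) :
    Prop :=
  ForAlmostAll (fun A : Matrix (Fin n) (Fin n) k => leadingIdeal m (changeVars A I) = J)

end QuasiStable

end

/-! Let `G` be the set of leading exponents of the ideal that `I` generates after substitution by a
matrix of indeterminates, over the coefficient ring `k[a_ij]`. A leading coefficient there is a
nonzero polynomial in the `a_ij`; where it does not vanish, the leading exponent survives
specialisation. By Dickson's lemma finitely many such conditions put `G` inside the leading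
exponents of `A · I`, and a rank comparison in each degree (`card_le_card_genericExps`) forces
equality. Over an infinite field two generic conditions hold simultaneously somewhere, hence
uniqueness.

Quasi-stability follows from one exchange property of `G`: for `i < j` the power `x_i ^ μ_i` may be
replaced by `x_j ^ μ_i`. Only the full power is traded, because its coefficient in `(x_i + x_j) ^
μ_i` is 1 in every characteristic. This suffices to bound the exponents of the Pommaret basis
(`finite_pommaretExps`).

For the exchange (`genericExps_exchange`), take elements of `A · I` with leading exponents in `G`,
at least `μ` and of its degree. Scale the variables by indeterminates `t`, apply `T : x_i ↦ x_i -
x_j`, and combine over `k[t]` so that no term above `μ` remains. The top coefficient in `t`, taken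
before `T`, is a nonzero `h` supported in `G`. As `T` creates no smaller terms, `T h = a x^μ`; so
`h` is `a` times the image of `x^μ` under `x_i ↦ x_i + x_j` and contains the exchanged term. -/

open MvPolynomial
open scoped MonomialOrder

noncomputable section

namespace QuasiStable

/-! ### Pommaret bases of upper sets of exponents. -/

section Combinatorics

variable {n : ℕ}

/-- The exponents of the terms in the Pommaret cone of `x ^ μ`. -/
def coneExps (μ : Fin n →₀ ℕ) : Set (Fin n →₀ ℕ) :=
  {ρ | μ ≤ ρ ∧ ∀ i j, j < i → μ j ≠ 0 → ρ i = μ i}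

/-- The elements of `G` all of whose proper Pommaret divisors lie outside of `G`. -/
def pommaretExps (G : Set (Fin n →₀ ℕ)) : Set (Fin n →₀ ℕ) :=
  {η | η ∈ G ∧ ∀ i, η i ≠ 0 → (∀ j < i, η j = 0) → η - Finsupp.single i 1 ∉ G}

lemma self_mem_coneExps (μ : Fin n →₀ ℕ) : μ ∈ coneExps μ := ⟨le_rfl, fun _ _ _ _ => rfl⟩

lemma exists_first_ne_zero {η : Fin n →₀ ℕ} {i : Fin n} (hi : η i ≠ 0) :
    ∃ c ≤ i, η c ≠ 0 ∧ ∀ j < c, η j = 0 := by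
  have hne : η.support.Nonempty := ⟨i, by simpa using hi⟩
  refine ⟨η.support.min' hne, Finset.min'_le _ _ (by simpa using hi), ?_, fun j hj => ?_⟩
  · simpa using η.support.min'_mem hne
  · by_contra h
    exact absurd (Finset.min'_le η.support j (by simpa using h)) (not_le.mpr hj)

/-- Descent: if `η` is not yet in the basis, dividing by its class variable stays in `G` and keeps
`μ` in the cone. -/
lemma exists_mem_pommaretExps {G : Set (Fin n →₀ ℕ)} {μ : Fin n →₀ ℕ} (hμ : μ ∈ G) :
    ∃ η ∈ pommaretExps G, μ ∈ coneExps η := by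
  suffices h : ∀ η ∈ G, μ ∈ coneExps η → ∃ η ∈ pommaretExps G, μ ∈ coneExps η from
    h μ hμ (self_mem_coneExps μ)
  intro η
  induction η using WellFoundedLT.induction with
  | ind η ih =>
    intro hη hc
    by_cases hp : η ∈ pommaretExps G
    · exact ⟨η, hp, hc⟩
    · simp only [pommaretExps, Set.mem_ofPred_eq, not_and, not_forall, not_not] at hp
      obtain ⟨i, hi, hlow, hmem⟩ := hp hη
      refine ih _ ?_ hmem ⟨tsub_le_self.trans hc.1, fun l j hjl hj => ?_⟩
      · refine lt_of_le_of_ne tsub_le_self fun h => ?_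
        have := DFunLike.congr_fun h i
        simp only [Finsupp.tsub_apply, Finsupp.single_eq_same] at this
        omega
      · have hj' : η j ≠ 0 := fun h => hj (by simp [h])
        have hij : i ≤ j := by
          by_contra h
          exact hj' (hlow j (not_le.mp h))
        have hil : i ≠ l := (hij.trans_lt hjl).ne
        rw [hc.2 l j hjl hj']
        simp [hil]

/-- If `η i < η' i`, then `η` vanishes below `i`, since above its class it agrees with `ρ ≥ η'`.
Then `η` divides the quotient of `η'` by its class variable, which puts that quotient in `G`. -/
lemma pommaretExps_le {G : Set (Fin n →₀ ℕ)} (hG : IsUpperSet G) {η η' ρ : Fin n →₀ ℕ}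
    (hη : η ∈ G) (hη' : η' ∈ pommaretExps G) (h : ρ ∈ coneExps η) (h' : ρ ∈ coneExps η') :
    η' ≤ η := by
  by_contra hle
  rw [Finsupp.le_def] at hle
  push Not at hle
  obtain ⟨i, hi⟩ := hle
  have hlow : ∀ j < i, η j = 0 := by
    intro j hj
    by_contra h0
    have h1 := h.2 i j hj h0
    have h2 := h'.1 i
    omega
  obtain ⟨c, hci, hc, hclow⟩ := exists_first_ne_zero (η := η') (i := i) (by omega)
  refine hη'.2 c hc hclow (hG ?_ hη)
  intro l
  simp only [Finsupp.tsub_apply, Finsupp.single_apply]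
  rcases lt_trichotomy l c with hlc | rfl | hlc
  · rw [hlow l (hlc.trans_le hci)]; exact Nat.zero_le _
  · rcases hci.lt_or_eq with h1 | rfl
    · rw [hlow _ h1]; exact Nat.zero_le _
    · simp; omega
  · have h1 := h'.2 l c hlc hc
    have h2 := h.1 l
    rw [if_neg hlc.ne]
    omega

lemma pommaretExps_unique {G : Set (Fin n →₀ ℕ)} (hG : IsUpperSet G) {η η' ρ : Fin n →₀ ℕ}
    (hη : η ∈ pommaretExps G) (hη' : η' ∈ pommaretExps G)
    (h : ρ ∈ coneExps η) (h' : ρ ∈ coneExps η') : η = η' :=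
  le_antisymm (pommaretExps_le hG hη'.1 hη h' h) (pommaretExps_le hG hη.1 hη' h h')

/-- Dickson's lemma. -/
lemma exists_finset_generators (G : Set (Fin n →₀ ℕ)) :
    ∃ B : Finset (Fin n →₀ ℕ), (B : Set (Fin n →₀ ℕ)) ⊆ G ∧ ∀ μ ∈ G, ∃ β ∈ B, β ≤ μ := by
  have hfin : {μ | Minimal (· ∈ G) μ}.Finite :=
    WellQuasiOrderedLE.finite_of_isAntichain (setOfPred_minimal_antichain _)
  refine ⟨hfin.toFinset, fun μ hμ => ?_, fun μ hμ => ?_⟩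
  · simp only [Set.Finite.coe_toFinset, Set.mem_ofPred_eq] at hμ
    exact hμ.prop
  · obtain ⟨β, hβμ, hβ⟩ := exists_minimal_le_of_wellFoundedLT (· ∈ G) μ hμ
    exact ⟨β, by simpa using hβ, hβμ⟩

/-- Let `D` bound the exponents of a finite generating set, and suppose `η l > 2 * D` with `l` above
the class `c` of `η`. In a generator `β ≤ η` trade `x_c` for `x_l`: the result has exponent `β l + β
c ≤ 2 * D` at `l` and 0 at `c`, so it divides `η` without one factor `x_c`. For `l = c` the
generator itself does. -/
lemma finite_pommaretExps {G : Set (Fin n →₀ ℕ)} (hG : IsUpperSet G)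
    (hex : ∀ μ ∈ G, ∀ i j, i < j → μ.erase i + Finsupp.single j (μ i) ∈ G) :
    (pommaretExps G).Finite := by
  obtain ⟨B, hBG, hB⟩ := exists_finset_generators G
  have hbound : ∀ η ∈ pommaretExps G,
      η ≤ Finsupp.equivFunOnFinite.symm fun _ => 2 * B.sup (fun β => Finset.univ.sup β) := by
    intro η hη l
    rw [Finsupp.equivFunOnFinite_symm_apply_apply]
    by_contra hlt
    push Not at hlt
    obtain ⟨c, hcl, hc, hclow⟩ := exists_first_ne_zero (η := η) (i := l) (by omega)
    obtain ⟨β, hβB, hβ⟩ := hB η hη.1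
    have hD : ∀ i, β i ≤ B.sup (fun β => Finset.univ.sup β) := fun i =>
      (Finset.le_sup (f := β) (Finset.mem_univ i)).trans
        (Finset.le_sup (f := fun β : Fin n →₀ ℕ => Finset.univ.sup β) hβB)
    rcases hcl.lt_or_eq with hcl | rfl
    · refine hη.2 c hc hclow (hG ?_ (hex β (hBG hβB) c l hcl))
      intro i
      have h1 := hβ i
      have h2 := hD i
      have h3 := hD c
      simp only [Finsupp.add_apply, Finsupp.erase_apply, Finsupp.single_apply,
        Finsupp.tsub_apply]
      by_cases hic : i = c
      · subst hic
        simp [hcl.ne']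
      · rw [if_neg hic, if_neg (Ne.symm hic)]
        by_cases hil : l = i
        · subst hil; simp; omega
        · simp [hil, h1]
    · refine hη.2 c hc hclow (hG ?_ (hBG hβB))
      intro i
      have h1 := hβ i
      have h2 := hD i
      simp only [Finsupp.tsub_apply, Finsupp.single_apply]
      split_ifs with h
      · subst h; omega
      · simpa using h1
  exact (Set.finite_Iic _).subset hbound

end Combinatorics

/-! ### From cones of exponents to direct sums of linear spaces. -/

section Cones

variable {k : Type*} [Field k] {n : ℕ}

/-- Reduces the direct sum decomposition to a partition of a set of exponents. -/
lemma pommaretCone_eq_restrictSupport (μ : Fin n →₀ ℕ) :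
    pommaretCone k μ = restrictSupport k (coneExps μ) := by
  apply le_antisymm
  · rintro _ ⟨g, hg, rfl⟩
    refine (mem_restrictSupport_iff k).2 fun ρ hρ => ?_
    simp only [SetLike.mem_coe, Subalgebra.mem_toSubmodule, mem_supported] at hg
    rw [Finset.mem_coe, mem_support_iff, LinearMap.mulRight_apply, coeff_mul_monomial'] at hρ
    obtain ⟨hle, hne⟩ : μ ≤ ρ ∧ coeff (ρ - μ) g ≠ 0 := by
      split_ifs at hρ with h
      · exact ⟨h, by simpa using hρ⟩
      · exact absurd rfl hρ
    refine ⟨hle, fun i j hji hj => ?_⟩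
    by_contra hi
    have hle' := hle i
    have hmem : i ∈ g.vars :=
      (mem_vars_iff_mem_support i).2 ⟨ρ - μ, mem_support_iff.2 hne, by simp; omega⟩
    exact absurd (hg hmem j (by simpa using hj)) (not_le.mpr hji)
  · rw [restrictSupport_eq_span, Submodule.span_le]
    rintro _ ⟨ρ, hρ, rfl⟩
    refine ⟨monomial (ρ - μ) 1, ?_, ?_⟩
    · simp only [SetLike.mem_coe, Subalgebra.mem_toSubmodule, mem_supported]
      rw [vars_monomial one_ne_zero]
      intro i hi j hj
      by_contra hji
      have := hρ.2 i j (not_le.mp hji) (by simpa using hj)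
      simp [this] at hi
    · simp [monomial_mul, tsub_add_cancel_of_le hρ.1]

lemma restrictSupport_iUnion {ι : Sort*} (s : ι → Set (Fin n →₀ ℕ)) :
    restrictSupport k (⋃ i, s i) = ⨆ i, restrictSupport k (s i) := by
  simp only [restrictSupport_eq_span, Set.image_iUnion, Submodule.span_iUnion]

lemma span_monomial_eq_restrictSupport {G : Set (Fin n →₀ ℕ)} (hG : IsUpperSet G) :
    (Ideal.span ((fun μ => monomial μ (1 : k)) '' G)).restrictScalars k = restrictSupport k G := by
  ext f
  rw [Submodule.restrictScalars_mem, mem_ideal_span_monomial_image, mem_restrictSupport_iff]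
  exact ⟨fun h ρ hρ => let ⟨_, hs, hle⟩ := h ρ hρ; hG hle hs, fun h ρ hρ => ⟨ρ, h hρ, le_rfl⟩⟩

/-- An upper set of exponents closed under the exchange of a variable for a larger one
generates a quasi-stable ideal. -/
lemma isQuasiStable_of_exchange {G : Set (Fin n →₀ ℕ)} (hG : IsUpperSet G)
    (hex : ∀ μ ∈ G, ∀ i j, i < j → μ.erase i + Finsupp.single j (μ i) ∈ G) :
    IsQuasiStable (Ideal.span ((fun μ => monomial μ (1 : k)) '' G)) := by
  have hfin := finite_pommaretExps hG hex
  have hmem : ∀ {η}, η ∈ hfin.toFinset ↔ η ∈ pommaretExps G := by simp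
  refine ⟨hfin.toFinset, ?_, ?_, ?_⟩
  · apply le_antisymm
    · rw [Ideal.span_le]
      rintro _ ⟨μ, hμ, rfl⟩
      obtain ⟨η, hη, hc⟩ := exists_mem_pommaretExps hμ
      rw [SetLike.mem_coe, mem_ideal_span_monomial_image]
      intro ρ hρ
      obtain rfl : ρ = μ := by simpa using support_monomial_subset hρ
      exact ⟨η, hmem.2 hη, hc.1⟩
    · exact Ideal.span_mono (Set.image_mono fun η hη => (hmem.1 hη).1)
  · intro η
    simp only [pommaretCone_eq_restrictSupport, ← restrictSupport_iUnion]
    rw [Submodule.disjoint_def]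
    intro f hf hf'
    by_contra h0
    obtain ⟨ρ, hρ⟩ := support_nonempty.2 h0
    have h1 := (mem_restrictSupport_iff k).1 hf hρ
    have h2 := (mem_restrictSupport_iff k).1 hf' hρ
    simp only [Set.mem_iUnion] at h2
    obtain ⟨η', hne, h2⟩ := h2
    exact hne (Subtype.ext (pommaretExps_unique hG (hmem.1 η'.2) (hmem.1 η.2) h2 h1))
  · simp only [pommaretCone_eq_restrictSupport, ← restrictSupport_iUnion]
    rw [span_monomial_eq_restrictSupport hG]
    congr 1
    ext μ
    simp only [Set.mem_iUnion]
    constructor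
    · rintro ⟨η, h⟩
      exact hG h.1 (hmem.1 η.2).1
    · intro hμ
      obtain ⟨η, hη, hc⟩ := exists_mem_pommaretExps hμ
      exact ⟨⟨η, hmem.2 hη⟩, hc⟩

end Cones

/-! ### Leading exponents, over a ring so as to cover generic coefficients. -/

section LeadingExponents

variable {R : Type*} [CommRing R] {n : ℕ} (m : MonomialOrder (Fin n))

/-- The exponents of the leading terms of the non-zero elements of `I`. -/
def leadExps (I : Ideal (MvPolynomial (Fin n) R)) : Set (Fin n →₀ ℕ) :=
  {μ | ∃ f ∈ I, f ≠ 0 ∧ m.degree f = μ}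

variable {m}

lemma degree_eq_of_coeff {f : MvPolynomial (Fin n) R} {μ : Fin n →₀ ℕ} (h : coeff μ f ≠ 0)
    (h' : ∀ ρ, μ ≺[m] ρ → coeff ρ f = 0) : m.degree f = μ :=
  m.toSyn.injective (le_antisymm
    (m.degree_le_iff.2 fun ρ hρ => not_lt.1 fun hlt => (mem_support_iff.1 hρ) (h' ρ hlt))
    (m.le_degree (mem_support_iff.2 h)))

lemma isUpperSet_leadExps [IsDomain R] (I : Ideal (MvPolynomial (Fin n) R)) :
    IsUpperSet (leadExps m I) := by
  classical
  rintro _ ν hle ⟨f, hf, h0, rfl⟩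
  have h1 : (monomial (ν - m.degree f) (1 : R)) ≠ 0 := by simp
  refine ⟨_, I.mul_mem_left (monomial (ν - m.degree f) 1) hf, mul_ne_zero h1 h0, ?_⟩
  rw [m.degree_mul h1 h0, m.degree_monomial, if_neg one_ne_zero, tsub_add_cancel_of_le hle]

variable {k : Type*} [Field k]

lemma leadingIdeal_eq_span_monomial (I : Ideal (MvPolynomial (Fin n) k)) :
    leadingIdeal m I = Ideal.span ((fun μ => monomial μ (1 : k)) '' leadExps m I) := by
  rw [leadingIdeal, m.span_leadingTerm_eq_span_monomial']
  congr 1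
  ext f
  constructor
  · rintro ⟨p, ⟨hp, h0⟩, rfl⟩
    exact ⟨_, ⟨p, hp, h0, rfl⟩, rfl⟩
  · rintro ⟨_, ⟨p, hp, h0, rfl⟩, rfl⟩
    exact ⟨p, ⟨hp, h0⟩, rfl⟩

lemma mem_leadExps_of_monomial_mem {I : Ideal (MvPolynomial (Fin n) k)} {μ : Fin n →₀ ℕ}
    (h : monomial μ (1 : k) ∈ leadingIdeal m I) : μ ∈ leadExps m I := by
  rw [leadingIdeal_eq_span_monomial, mem_ideal_span_monomial_image] at h
  obtain ⟨ν, hν, hle⟩ := h μ (by simp)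
  exact isUpperSet_leadExps I hle hν

/-- At the largest `ν` with `c ν ≠ 0` only one summand contributes. -/
lemma eq_zero_of_sum_eq_zero {L : Finset (Fin n →₀ ℕ)} {f : L → MvPolynomial (Fin n) k}
    (hf : ∀ ν, f ν ≠ 0) (hdeg : ∀ ν, m.degree (f ν) = ν) {c : L → k}
    (h : ∑ ν, C (c ν) * f ν = 0) : c = 0 := by
  classical
  by_contra hc
  obtain ⟨ν₀, hν₀⟩ := Function.ne_iff.1 hc
  obtain ⟨ν, hν, hmax⟩ := (Finset.univ.filter fun ν => c ν ≠ 0).exists_max_image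
    (fun ν => m.toSyn ν) ⟨ν₀, by simpa using hν₀⟩
  simp only [Finset.mem_filter, Finset.mem_univ, true_and] at hν hmax
  have hcoeff := congrArg (coeff (ν : Fin n →₀ ℕ)) h
  simp only [coeff_sum, coeff_C_mul, coeff_zero] at hcoeff
  rw [Finset.sum_eq_single ν] at hcoeff
  · refine mul_ne_zero hν ?_ hcoeff
    rw [← hdeg ν]
    exact m.coeff_degree_ne_zero_iff.2 (hf ν)
  · intro ν' _ hne
    by_cases h0 : c ν' = 0
    · simp [h0]
    · rw [m.coeff_eq_zero_of_lt, mul_zero]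
      rw [hdeg]
      exact lt_of_le_of_ne (hmax ν' h0) fun he => hne (Subtype.ext (m.toSyn.injective he))
  · simp

end LeadingExponents

/-! ### Linear substitutions. -/

section LinearSubst

variable {k : Type*} [Field k] {n : ℕ}

lemma linearSubst_X (A : Matrix (Fin n) (Fin n) k) (i : Fin n) :
    linearSubst A (X i) = ∑ j, C (A i j) * X j := by
  simp [linearSubst]

lemma linearSubst_C (A : Matrix (Fin n) (Fin n) k) (a : k) : linearSubst A (C a) = C a :=
  (linearSubst A).commutes a

lemma linearSubst_linearSubst (A B : Matrix (Fin n) (Fin n) k) (f : MvPolynomial (Fin n) k) :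
    linearSubst B (linearSubst A f) = linearSubst (A * B) f := by
  have : (linearSubst B).comp (linearSubst A) = linearSubst (A * B) := by
    refine algHom_ext fun i => ?_
    simp only [AlgHom.comp_apply, linearSubst_X, map_sum, map_mul, linearSubst_C,
      Matrix.mul_apply, Finset.mul_sum, Finset.sum_mul]
    rw [Finset.sum_comm]
    simp only [mul_assoc]
  exact DFunLike.congr_fun this f

lemma linearSubst_one (f : MvPolynomial (Fin n) k) :
    linearSubst (1 : Matrix (Fin n) (Fin n) k) f = f := by
  have : linearSubst (1 : Matrix (Fin n) (Fin n) k) = AlgHom.id k _ := by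
    refine algHom_ext fun i => ?_
    simp [linearSubst_X, Matrix.one_apply]
  exact DFunLike.congr_fun this f

lemma linearSubst_bijective {A : Matrix (Fin n) (Fin n) k} (hA : A.det ≠ 0) :
    Function.Bijective (linearSubst A) := by
  refine Function.bijective_iff_has_inverse.2 ⟨linearSubst A⁻¹, fun f => ?_, fun f => ?_⟩
  · rw [linearSubst_linearSubst, A.mul_nonsing_inv (isUnit_iff_ne_zero.2 hA), linearSubst_one]
  · rw [linearSubst_linearSubst, A.nonsing_inv_mul (isUnit_iff_ne_zero.2 hA), linearSubst_one]

lemma mem_changeVars {A : Matrix (Fin n) (Fin n) k} (hA : A.det ≠ 0)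
    {I : Ideal (MvPolynomial (Fin n) k)} {f : MvPolynomial (Fin n) k} :
    f ∈ changeVars A I ↔ ∃ g ∈ I, linearSubst A g = f :=
  Ideal.mem_map_iff_of_surjective (linearSubst A) (linearSubst_bijective hA).2

lemma isHomogeneous_linearSubst (A : Matrix (Fin n) (Fin n) k) {f : MvPolynomial (Fin n) k}
    {d : ℕ} (hf : f.IsHomogeneous d) : (linearSubst A f).IsHomogeneous d := by
  have := hf.aeval (fun i => ∑ j, C (A i j) * X j) (n := 1)
    fun i => IsHomogeneous.sum _ _ _ fun j _ => isHomogeneous_C_mul_X _ _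
  simpa [linearSubst] using this

lemma homogeneousComponent_linearSubst (A : Matrix (Fin n) (Fin n) k) (d : ℕ)
    (f : MvPolynomial (Fin n) k) :
    homogeneousComponent d (linearSubst A f) = linearSubst A (homogeneousComponent d f) := by
  induction f using MvPolynomial.induction_on' with
  | monomial e c =>
    have h := isHomogeneous_monomial (σ := Fin n) c (rfl : e.degree = e.degree)
    rw [homogeneousComponent_of_mem h,
      homogeneousComponent_of_mem (isHomogeneous_linearSubst A h)]
    split_ifs <;> simp
  | add p q hp hq => simp [map_add, hp, hq]

/-- The order need not refine the degree, but the component of degree `|μ|` keeps the coefficient at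
`μ` and gains no larger term; taking components commutes with the substitution. -/
lemma exists_isHomogeneous_of_mem_leadExps {m : MonomialOrder (Fin n)}
    {I : Ideal (MvPolynomial (Fin n) k)}
    (hI : I.IsHomogeneous (homogeneousSubmodule (Fin n) k)) {A : Matrix (Fin n) (Fin n) k}
    (hA : A.det ≠ 0) {μ : Fin n →₀ ℕ} (hμ : μ ∈ leadExps m (changeVars A I)) :
    ∃ g ∈ I, g.IsHomogeneous μ.degree ∧ linearSubst A g ≠ 0 ∧ m.degree (linearSubst A g) = μ := by
  obtain ⟨f, hf, h0, hdeg⟩ := hμ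
  obtain ⟨g, hg, rfl⟩ := (mem_changeVars hA).1 hf
  have hc : coeff μ (linearSubst A (homogeneousComponent μ.degree g)) ≠ 0 := by
    rw [← homogeneousComponent_linearSubst, coeff_homogeneousComponent, if_pos rfl, ← hdeg]
    exact m.coeff_degree_ne_zero_iff.2 h0
  refine ⟨homogeneousComponent μ.degree g, homogeneousComponent_mem_of_mem hI hg _,
    homogeneousComponent_isHomogeneous _ _, fun h => hc (by simp [h]),
    degree_eq_of_coeff hc fun ρ hρ => ?_⟩
  rw [← homogeneousComponent_linearSubst, coeff_homogeneousComponent,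
    m.coeff_eq_zero_of_lt (hdeg ▸ hρ), ite_self]

end LinearSubst

/-! ### Calculus of generic conditions. -/

section AlmostAll

variable {k : Type*} [Field k] {n : ℕ}

lemma ForAlmostAll.mono {P Q : Matrix (Fin n) (Fin n) k → Prop} (hP : ForAlmostAll P)
    (h : ∀ A, A.det ≠ 0 → P A → Q A) : ForAlmostAll Q :=
  let ⟨p, hp, hpP⟩ := hP
  ⟨p, hp, fun A hA hpA => h A hA (hpP A hA hpA)⟩

lemma ForAlmostAll.and {P Q : Matrix (Fin n) (Fin n) k → Prop} (hP : ForAlmostAll P)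
    (hQ : ForAlmostAll Q) : ForAlmostAll fun A => P A ∧ Q A := by
  obtain ⟨p, hp, hpP⟩ := hP
  obtain ⟨q, hq, hqQ⟩ := hQ
  refine ⟨p * q, mul_ne_zero hp hq, fun A hA h => ?_⟩
  rw [map_mul] at h
  exact ⟨hpP A hA (left_ne_zero_of_mul h), hqQ A hA (right_ne_zero_of_mul h)⟩

lemma ForAlmostAll.ball_finset {α : Type*} (s : Finset α)
    {P : α → Matrix (Fin n) (Fin n) k → Prop} (h : ∀ x ∈ s, ForAlmostAll (P x)) :
    ForAlmostAll fun A => ∀ x ∈ s, P x A := by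
  classical
  induction s using Finset.induction_on with
  | empty => exact ⟨1, one_ne_zero, by simp⟩
  | insert a s _ ih =>
    refine ((h a (Finset.mem_insert_self a s)).and
      (ih fun x hx => h x (Finset.mem_insert_of_mem hx))).mono fun A _ hA x hx => ?_
    rcases Finset.mem_insert.1 hx with rfl | hx
    · exact hA.1
    · exact hA.2 x hx

lemma exists_eval_ne_zero [Infinite k] {σ : Type*} {p : MvPolynomial σ k} (hp : p ≠ 0) :
    ∃ x, eval x p ≠ 0 := by
  by_contra! h
  exact hp (MvPolynomial.funext fun x => by simp [h x])

lemma exists_det_ne_zero_and_eval_ne_zero [Infinite k] {p : MvPolynomial (Fin n × Fin n) k}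
    (hp : p ≠ 0) : ∃ A : Matrix (Fin n) (Fin n) k, A.det ≠ 0 ∧
      eval (fun ij : Fin n × Fin n => A ij.1 ij.2) p ≠ 0 := by
  obtain ⟨x, hx⟩ := exists_eval_ne_zero (mul_ne_zero (Matrix.det_mvPolynomialX_ne_zero (Fin n) k) hp)
  rw [map_mul] at hx
  refine ⟨Matrix.of fun i j => x (i, j), ?_, right_ne_zero_of_mul hx⟩
  have := left_ne_zero_of_mul hx
  rwa [RingHom.map_det, RingHom.mapMatrix_apply, show (Matrix.mvPolynomialX (Fin n) (Fin n) k).map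
    (eval x) = Matrix.of fun i j => x (i, j) by ext; simp] at this

lemma ForAlmostAll.exists [Infinite k] {P : Matrix (Fin n) (Fin n) k → Prop}
    (hP : ForAlmostAll P) : ∃ A : Matrix (Fin n) (Fin n) k, A.det ≠ 0 ∧ P A :=
  let ⟨_, hp, hpP⟩ := hP
  let ⟨A, hA, hpA⟩ := exists_det_ne_zero_and_eval_ne_zero hp
  ⟨A, hA, hpP A hA hpA⟩

end AlmostAll

/-! ### Existence of the generic initial ideal. -/

section Generic

variable {k : Type*} [Field k] {n : ℕ} {m : MonomialOrder (Fin n)}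

variable (k n) in
/-- The linear substitution whose coefficients are independent indeterminates. -/
def genericSubst : MvPolynomial (Fin n) k →ₐ[k]
    MvPolynomial (Fin n) (MvPolynomial (Fin n × Fin n) k) :=
  aeval fun i => ∑ j, C (X (i, j)) * X j

lemma map_eval_genericSubst (A : Matrix (Fin n) (Fin n) k) (f : MvPolynomial (Fin n) k) :
    MvPolynomial.map (eval fun ij : Fin n × Fin n => A ij.1 ij.2) (genericSubst k n f) =
      linearSubst A f := by
  have : (MvPolynomial.map (eval fun ij : Fin n × Fin n => A ij.1 ij.2)).comp
      (genericSubst k n).toRingHom = (linearSubst A).toRingHom := by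
    refine MvPolynomial.ringHom_ext (fun a => ?_) fun i => ?_
    · simp [genericSubst, linearSubst, MvPolynomial.algebraMap_apply,
        MvPolynomial.algebraMap_eq]
    · simp [genericSubst, linearSubst]
  exact DFunLike.congr_fun this f

variable (m) in
/-- The leading exponents of the transform of `I` under the generic linear substitution. -/
def genericExps (I : Ideal (MvPolynomial (Fin n) k)) : Set (Fin n →₀ ℕ) :=
  leadExps m (I.map (genericSubst k n))

/-- The leading coefficient of a generic element is itself the polynomial whose non-vanishing is
required. -/
lemma forAlmostAll_mem_leadExps {I : Ideal (MvPolynomial (Fin n) k)} {μ : Fin n →₀ ℕ}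
    (hμ : μ ∈ genericExps m I) : ForAlmostAll fun A => μ ∈ leadExps m (changeVars A I) := by
  obtain ⟨f, hf, h0, rfl⟩ := hμ
  refine ⟨m.leadingCoeff f, m.leadingCoeff_ne_zero_iff.2 h0, fun A _ hA => ?_⟩
  set e := MvPolynomial.map (σ := Fin n) (eval fun ij : Fin n × Fin n => A ij.1 ij.2)
  have hc : coeff (m.degree f) (e f) ≠ 0 := by rwa [coeff_map]
  refine ⟨e f, ?_, fun h => hc (by simp [h]), degree_eq_of_coeff hc fun ρ hρ => ?_⟩
  · have hle : I.map (genericSubst k n) ≤ (changeVars A I).comap e := by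
      rw [Ideal.map_le_iff_le_comap]
      intro g hg
      rw [Ideal.mem_comap, Ideal.mem_comap, map_eval_genericSubst]
      exact Ideal.mem_map_of_mem _ hg
    exact hle hf
  · rw [coeff_map, m.coeff_eq_zero_of_lt hρ, map_zero]

lemma forAlmostAll_genericExps_subset (I : Ideal (MvPolynomial (Fin n) k)) :
    ForAlmostAll fun A => genericExps m I ⊆ leadExps m (changeVars A I) := by
  obtain ⟨B, hBG, hB⟩ := exists_finset_generators (genericExps m I)
  refine (ForAlmostAll.ball_finset B fun β hβ => forAlmostAll_mem_leadExps (hBG hβ)).mono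
    fun A _ hA μ hμ => ?_
  obtain ⟨β, hβ, hle⟩ := hB μ hμ
  exact isUpperSet_leadExps _ hle (hA β hβ)

lemma isHomogeneous_genericSubst {f : MvPolynomial (Fin n) k} {d : ℕ} (hf : f.IsHomogeneous d) :
    (genericSubst k n f).IsHomogeneous d := by
  have := hf.aeval (fun i => ∑ j, C (X (i, j) : MvPolynomial (Fin n × Fin n) k) * X j) (n := 1)
    fun i => IsHomogeneous.sum _ _ _ fun j _ => isHomogeneous_C_mul_X _ _
  simpa [genericSubst] using this

variable [Infinite k]

/-- Over the generic linear substitution the leading exponents of every degree are at least as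
many as over any regular one. -/
lemma card_le_card_genericExps {I : Ideal (MvPolynomial (Fin n) k)}
    (hI : I.IsHomogeneous (homogeneousSubmodule (Fin n) k)) {A : Matrix (Fin n) (Fin n) k}
    (hA : A.det ≠ 0) {d : ℕ} {L S : Finset (Fin n →₀ ℕ)}
    (hL : ∀ ν ∈ L, ν ∈ leadExps m (changeVars A I) ∧ ν.degree = d)
    (hS : ∀ ν, ν ∈ genericExps m I → ν.degree = d → ν ∈ S) : L.card ≤ S.card := by
  have hex : ∀ ν : L, ∃ g ∈ I, g.IsHomogeneous d ∧ linearSubst A g ≠ 0 ∧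
      m.degree (linearSubst A g) = ν := fun ν => by
    obtain ⟨h1, h2⟩ := hL ν ν.2
    subst h2
    exact exists_isHomogeneous_of_mem_leadExps hI hA h1
  choose g hgI hgd hg0 hgdeg using hex
  let Φ : (L → MvPolynomial (Fin n × Fin n) k) →ₗ[MvPolynomial (Fin n × Fin n) k]
      MvPolynomial (Fin n) (MvPolynomial (Fin n × Fin n) k) :=
    Fintype.linearCombination _ fun ν => genericSubst k n (g ν)
  have hΦ : ∀ c, Φ c = ∑ ν, C (c ν) * genericSubst k n (g ν) := fun c => by
    simp [Φ, Fintype.linearCombination_apply, smul_eq_C_mul]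
  -- A relation over `k[a_ij]` specialises at some invertible `B` to a nontrivial relation over `k`;
  -- undoing `B` and applying `A` contradicts the distinct leading exponents.
  have hΦinj : ∀ c, Φ c = 0 → c = 0 := by
    intro c hc
    by_contra hne
    obtain ⟨ν₀, hν₀⟩ := Function.ne_iff.1 hne
    obtain ⟨B, hB, hcB⟩ := exists_det_ne_zero_and_eval_ne_zero hν₀
    set ev := eval fun ij : Fin n × Fin n => B ij.1 ij.2
    have h1 : linearSubst B (∑ ν, C (ev (c ν)) * g ν) = 0 := by
      have := congrArg (MvPolynomial.map (σ := Fin n) ev) ((hΦ c).symm.trans hc)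
      simpa [ev, map_eval_genericSubst, linearSubst_C] using this
    have h2 := (map_eq_zero_iff (linearSubst B) (linearSubst_bijective hB).1).1 h1
    have h3 := congrArg (linearSubst A) h2
    simp only [map_sum, map_mul, linearSubst_C, map_zero] at h3
    exact hcB (congrFun (eq_zero_of_sum_eq_zero hg0 hgdeg h3) ν₀)
  -- Reading off only the coefficients at `S` stays injective: a nonzero value of `Φ` lies in the
  -- generic ideal, so its leading exponent belongs to `S`.
  let Ψ : (L → MvPolynomial (Fin n × Fin n) k) →ₗ[MvPolynomial (Fin n × Fin n) k]
      (S → MvPolynomial (Fin n × Fin n) k) :=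
    LinearMap.pi fun ρ : S => (lcoeff _ (ρ : Fin n →₀ ℕ)).comp Φ
  have hΨ : Function.Injective Ψ := by
    rw [← LinearMap.ker_eq_bot, LinearMap.ker_eq_bot']
    intro c hc
    refine hΦinj c ?_
    by_contra h0
    have hmem : Φ c ∈ I.map (genericSubst k n) := by
      rw [hΦ]
      exact Ideal.sum_mem _ fun ν _ => Ideal.mul_mem_left _ _ (Ideal.mem_map_of_mem _ (hgI ν))
    have hhom : (Φ c).IsHomogeneous d := by
      rw [hΦ]
      exact IsHomogeneous.sum _ _ _ fun ν _ => (isHomogeneous_genericSubst (hgd ν)).C_mul _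
    have hlead := m.degree_mem_support h0
    have hd : (m.degree (Φ c)).degree = d := by
      rw [Finsupp.degree_apply]
      exact (hhom.degree_eq_sum_deg_support hlead).symm
    have := congrFun hc ⟨_, hS _ ⟨_, hmem, h0, rfl⟩ hd⟩
    exact mem_support_iff.1 hlead this
  simpa using card_le_of_injective _ Ψ hΨ

lemma leadExps_eq_genericExps {I : Ideal (MvPolynomial (Fin n) k)}
    (hI : I.IsHomogeneous (homogeneousSubmodule (Fin n) k)) {A : Matrix (Fin n) (Fin n) k}
    (hA : A.det ≠ 0) (h : genericExps m I ⊆ leadExps m (changeVars A I)) :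
    leadExps m (changeVars A I) = genericExps m I := by
  classical
  refine (Set.Subset.antisymm h fun μ hμ => ?_).symm
  have hfin := Finsupp.finite_of_degree_eq (σ := Fin n) μ.degree
  let T (G : Set (Fin n →₀ ℕ)) : Finset (Fin n →₀ ℕ) := hfin.toFinset.filter (· ∈ G)
  have hT : ∀ {G ν}, ν ∈ T G ↔ ν.degree = μ.degree ∧ ν ∈ G := by simp [T]
  have heq : T (genericExps m I) = T (leadExps m (changeVars A I)) :=
    Finset.eq_of_subset_of_card_le (fun ν hν => hT.2 ⟨(hT.1 hν).1, h (hT.1 hν).2⟩)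
      (card_le_card_genericExps (d := μ.degree) hI hA (fun ν hν => (hT.1 hν).symm)
        fun ν h1 h2 => hT.2 ⟨h2, h1⟩)
  exact (hT.1 (heq ▸ hT.2 ⟨rfl, hμ⟩)).2

/-- Galligo's theorem. -/
lemma forAlmostAll_leadExps_eq {I : Ideal (MvPolynomial (Fin n) k)}
    (hI : I.IsHomogeneous (homogeneousSubmodule (Fin n) k)) :
    ForAlmostAll fun A => leadExps m (changeVars A I) = genericExps m I :=
  (forAlmostAll_genericExps_subset I).mono fun _ hA h => leadExps_eq_genericExps hI hA h

end Generic

/-! ### The exchange property of the generic leading exponents. -/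

section Exchange

variable {k : Type*} [Field k] {n : ℕ} {m : MonomialOrder (Fin n)}

lemma linearSubst_diagonal_X (t : Fin n → k) (i : Fin n) :
    linearSubst (Matrix.diagonal t) (X i) = C (t i) * X i := by
  rw [linearSubst_X, Finset.sum_eq_single i]
  · simp
  · intro j _ hj
    simp [Matrix.diagonal_apply_ne _ hj.symm]
  · simp

lemma linearSubst_diagonal_monomial (t : Fin n → k) (s : Fin n →₀ ℕ) (a : k) :
    linearSubst (Matrix.diagonal t) (monomial s a) = monomial s (eval t (monomial s a)) := by
  rw [monomial_eq, map_mul, linearSubst_C, Finsupp.prod, map_prod, map_mul, eval_C, map_prod]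
  simp only [map_pow, linearSubst_diagonal_X, mul_pow, eval_X, Finset.prod_mul_distrib]
  rw [monomial_eq, Finsupp.prod, map_mul, map_prod, mul_assoc]
  simp only [map_pow]

lemma linearSubst_diagonal (t : Fin n → k) (f : MvPolynomial (Fin n) k) :
    linearSubst (Matrix.diagonal t) f =
      ∑ s ∈ f.support, monomial s (eval t (monomial s (coeff s f))) := by
  conv_lhs => rw [f.as_sum, map_sum]
  simp only [linearSubst_diagonal_monomial]

lemma coeff_linearSubst_diagonal (t : Fin n → k) (f : MvPolynomial (Fin n) k) (ρ : Fin n →₀ ℕ) :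
    coeff ρ (linearSubst (Matrix.diagonal t) f) = eval t (monomial ρ (coeff ρ f)) := by
  classical
  rw [linearSubst_diagonal, coeff_sum]
  simp only [coeff_monomial]
  rw [Finset.sum_ite_eq']
  split_ifs with h
  · rfl
  · rw [notMem_support_iff.1 h, monomial_zero, map_zero]

lemma linearSubst_transvection_X (i j : Fin n) (c : k) (l : Fin n) :
    linearSubst (Matrix.transvection i j c) (X l) = if l = i then X i + C c * X j else X l := by
  rw [linearSubst_X]
  simp only [Matrix.transvection, Matrix.add_apply, map_add, add_mul, Finset.sum_add_distrib,
    Matrix.one_apply, Matrix.single_apply]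
  by_cases h : l = i
  · subst h
    have : ∀ x, C (if j = x then c else 0) * X x =
        if j = x then (C c * X x : MvPolynomial (Fin n) k) else 0 := fun x => by split_ifs <;> simp
    simp [this]
  · simp [h, Ne.symm h]

lemma toSyn_le_of_mem_support_mul {f g : MvPolynomial (Fin n) k} {a b ρ : Fin n →₀ ℕ}
    (hf : ∀ ρ ∈ f.support, a ≼[m] ρ) (hg : ∀ ρ ∈ g.support, b ≼[m] ρ)
    (hρ : ρ ∈ (f * g).support) : a + b ≼[m] ρ := by
  classical
  obtain ⟨σ, hσ, τ, hτ, rfl⟩ := Finset.mem_add.1 (support_mul f g hρ)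
  rw [map_add, map_add]
  exact add_le_add (hf σ hσ) (hg τ hτ)

/-- Substituting `x i + c * x j` for `x i`, where `x j` is the larger variable, does not create
smaller terms. -/
lemma toSyn_le_of_mem_support_transvection {i j : Fin n}
    (hij : Finsupp.single i 1 ≼[m] Finsupp.single j 1) (c : k) (ν : Fin n →₀ ℕ) :
    ∀ ρ ∈ (linearSubst (Matrix.transvection i j c) (monomial ν (1 : k))).support, ν ≼[m] ρ := by
  classical
  induction ν using Finsupp.induction_linear with
  | zero => simp
  | add a b ha hb =>
    intro ρ hρ
    rw [← one_mul (1 : k), ← monomial_mul, map_mul] at hρ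
    exact toSyn_le_of_mem_support_mul ha hb hρ
  | single l e =>
    induction e with
    | zero => simp
    | succ e ih =>
      intro ρ hρ
      rw [Finsupp.single_add, ← one_mul (1 : k), ← monomial_mul, map_mul] at hρ
      rw [Finsupp.single_add]
      refine toSyn_le_of_mem_support_mul ih (fun σ hσ => ?_) hρ
      change σ ∈ (linearSubst _ (X l)).support at hσ
      rw [linearSubst_transvection_X] at hσ
      split_ifs at hσ with h
      · subst h
        rcases Finset.mem_union.1 (support_add hσ) with hσ | hσ
        · rw [support_X, Finset.mem_singleton] at hσ
          exact hσ ▸ le_rfl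
        · rw [C_mul_X_eq_monomial] at hσ
          rw [Finset.mem_singleton.1 (support_monomial_subset hσ)]
          exact hij
      · rw [support_X, Finset.mem_singleton] at hσ
        exact hσ ▸ le_rfl

/-- Setting `x_i = 0` after the transvection amounts to renaming `x_i` to `x_j`, and it preserves
the coefficient because `x_i` is absent from the exchanged term. -/
lemma coeff_transvection_monomial {i j : Fin n} (hij : i ≠ j) (μ : Fin n →₀ ℕ) (b : k) :
    coeff (μ.erase i + Finsupp.single j (μ i))
      (linearSubst (Matrix.transvection i j 1) (monomial μ b)) = b := by
  classical
  set μ' := μ.erase i + Finsupp.single j (μ i) with hμ'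
  set t : Fin n → k := fun l => if l = i then 0 else 1 with ht
  let φ : Fin n → Fin n := fun l => if l = i then j else l
  have hren : linearSubst (Matrix.diagonal t) (linearSubst (Matrix.transvection i j 1)
      (monomial μ b)) = rename φ (monomial μ b) := by
    have : (linearSubst (Matrix.diagonal t)).comp (linearSubst (Matrix.transvection i j 1)) =
        rename φ := by
      refine algHom_ext fun l => ?_
      rw [AlgHom.comp_apply, linearSubst_transvection_X, rename_X]
      by_cases h : l = i
      · subst h
        rw [if_pos rfl, map_add, map_mul, linearSubst_C, linearSubst_diagonal_X,
          linearSubst_diagonal_X]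
        simp [ht, φ, hij.symm]
      · rw [if_neg h, linearSubst_diagonal_X]
        simp [ht, φ, h]
    exact DFunLike.congr_fun this _
  have hmap : μ.mapDomain φ = μ' := by
    conv_lhs => rw [← Finsupp.erase_add_single i μ]
    rw [Finsupp.mapDomain_add, Finsupp.mapDomain_single, hμ']
    congr 1
    · rw [Finsupp.mapDomain_congr (g := id), Finsupp.mapDomain_id]
      intro l hl
      have : l ≠ i := by
        rintro rfl
        simp at hl
      simp [φ, this]
    · simp [φ]
  have h := congrArg (coeff μ') hren
  rw [rename_monomial, hmap, coeff_monomial, if_pos rfl, coeff_linearSubst_diagonal,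
    eval_monomial] at h
  rw [Finsupp.prod, Finset.prod_eq_one, mul_one] at h
  · exact h
  · intro l hl
    have : l ≠ i := by
      rintro rfl
      simp [hμ', hij.symm] at hl
    simp [ht, this]

/-- The coefficient at `x ^ ρ` of the polynomial obtained from `f` by first scaling the variables
with indeterminates and then substituting with `T`. -/
def scaledCoeff (T : Matrix (Fin n) (Fin n) k) (ρ : Fin n →₀ ℕ) (f : MvPolynomial (Fin n) k) :
    MvPolynomial (Fin n) k :=
  ∑ s ∈ f.support, monomial s (coeff s f * coeff ρ (linearSubst T (monomial s 1)))

lemma eval_scaledCoeff (T : Matrix (Fin n) (Fin n) k) (ρ : Fin n →₀ ℕ) (f : MvPolynomial (Fin n) k)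
    (t : Fin n → k) : eval t (scaledCoeff T ρ f) =
      coeff ρ (linearSubst T (linearSubst (Matrix.diagonal t) f)) := by
  have h : ∀ (s : Fin n →₀ ℕ) (a : k),
      linearSubst T (monomial s a) = C a * linearSubst T (monomial s 1) := fun s a => by
    rw [← linearSubst_C T, ← map_mul, C_mul_monomial, mul_one]
  rw [scaledCoeff, linearSubst_diagonal, map_sum, map_sum, coeff_sum]
  refine Finset.sum_congr rfl fun s _ => ?_
  rw [h s (eval t _), coeff_C_mul, eval_monomial, eval_monomial]
  ring

lemma eval_aeval_matrix {σ : Type*} (p : MvPolynomial (Fin n × Fin n) k)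
    (M : Matrix (Fin n) (Fin n) (MvPolynomial σ k)) (x : σ → k) :
    eval x (aeval (fun ij : Fin n × Fin n => M ij.1 ij.2) p) =
      eval (fun ij : Fin n × Fin n => M.map (eval x) ij.1 ij.2) p := by
  induction p using MvPolynomial.induction_on with
  | C a => simp [MvPolynomial.algebraMap_eq]
  | add p q hp hq => simp only [map_add, hp, hq]
  | mul_X p i hp => simp only [map_mul, hp, aeval_X, eval_X, Matrix.map_apply]

lemma ForAlmostAll.mul_right [Infinite k] {P : Matrix (Fin n) (Fin n) k → Prop}
    {T : Matrix (Fin n) (Fin n) k} (hT : T.det ≠ 0) (hP : ForAlmostAll P) :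
    ForAlmostAll fun A => P (A * T) := by
  obtain ⟨p, hp, hpP⟩ := hP
  have hev : ∀ A : Matrix (Fin n) (Fin n) k,
      eval (fun ij : Fin n × Fin n => A ij.1 ij.2) (aeval (fun ij : Fin n × Fin n =>
        (Matrix.mvPolynomialX (Fin n) (Fin n) k * T.map C :
          Matrix (Fin n) (Fin n) (MvPolynomial (Fin n × Fin n) k)) ij.1 ij.2) p) =
      eval (fun ij : Fin n × Fin n => (A * T) ij.1 ij.2) p := fun A => by
    rw [eval_aeval_matrix, Matrix.map_mul]
    congr 3
    ext ij
    simp [Matrix.mul_apply]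
  -- The polynomial `p(A T)` is nonzero: at `A T⁻¹` it takes the value `p(A)`.
  refine ⟨_, fun h0 => ?_, fun A hA h => hpP _ (by simp [hA, hT]) ((hev A) ▸ h)⟩
  obtain ⟨A, _, hA⟩ := exists_det_ne_zero_and_eval_ne_zero hp
  apply hA
  have := hev (A * T⁻¹)
  rw [h0, map_zero, T.nonsing_inv_mul_cancel_right A (isUnit_iff_ne_zero.2 hT)] at this
  exact this.symm

/-- Scaling marks the term `x^s` of `f` with `t^s`, so when `τ` is at least the top degree of the
product, only the leading term of `f` can reach `t^τ`. -/
lemma coeff_mul_scaledCoeff {T : Matrix (Fin n) (Fin n) k} {ρ τ : Fin n →₀ ℕ}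
    {f c : MvPolynomial (Fin n) k} (hτ : c ≠ 0 → m.degree c + m.degree f ≼[m] τ) :
    coeff τ (c * scaledCoeff T ρ f) =
      coeff τ (c * monomial (m.degree f) 1) * m.leadingCoeff f *
        coeff ρ (linearSubst T (monomial (m.degree f) 1)) := by
  classical
  by_cases hc : c = 0
  · simp [hc]
  have hterm : ∀ s a, coeff τ (c * monomial s a) = a * coeff τ (c * monomial s (1 : k)) :=
    fun s a => by
      rw [← mul_one a, ← C_mul_monomial, mul_left_comm, coeff_C_mul, mul_one]
  rw [scaledCoeff, Finset.mul_sum, coeff_sum, Finset.sum_eq_single (m.degree f)]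
  · rw [hterm, MonomialOrder.leadingCoeff]
    ring
  · intro s hs hne
    rw [hterm, m.coeff_eq_zero_of_lt (f := c * monomial s 1), mul_zero]
    refine lt_of_lt_of_le (lt_of_le_of_lt m.degree_mul_le ?_) (hτ hc)
    rw [m.degree_monomial, if_neg one_ne_zero, map_add, map_add]
    exact add_lt_add_right (lt_of_le_of_ne (m.le_degree hs) fun h => hne (m.toSyn.injective h)) _
  · intro h
    rw [hterm, notMem_support_iff.1 h, zero_mul, zero_mul]

lemma exists_ne_zero_mulVec_eq_zero {R : Type*} [CommRing R] [Nontrivial R] {α β : Type*}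
    [Fintype α] [Fintype β] (h : Fintype.card β < Fintype.card α) (M : Matrix β α R) :
    ∃ c ≠ 0, M.mulVec c = 0 := by
  by_contra! hc
  refine h.not_ge (card_le_of_injective R M.mulVecLin ?_)
  rw [← LinearMap.ker_eq_bot, LinearMap.ker_eq_bot']
  intro c h0
  by_contra hne
  exact hc c hne h0

variable [Infinite k]

/-- Coefficients above `μ` need to be killed only at exponents in `G`. The largest surviving
exponent would, for generic `t`, be a leading exponent of `A · diag(t) · T` applied to `I`, hence
lie in `G`. -/
lemma sum_mul_scaledCoeff_eq_zero {I : Ideal (MvPolynomial (Fin n) k)}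
    {G : Set (Fin n →₀ ℕ)} {p : MvPolynomial (Fin n × Fin n) k}
    (hp : ∀ A : Matrix (Fin n) (Fin n) k, A.det ≠ 0 →
      eval (fun ij : Fin n × Fin n => A ij.1 ij.2) p ≠ 0 → leadExps m (changeVars A I) = G)
    {A T : Matrix (Fin n) (Fin n) k} (hA : A.det ≠ 0) (hT : T.det ≠ 0)
    (hAT : eval (fun ij : Fin n × Fin n => (A * T) ij.1 ij.2) p ≠ 0)
    {d : ℕ} {ι : Type*} [Fintype ι] {g : ι → MvPolynomial (Fin n) k} (hgI : ∀ ν, g ν ∈ I)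
    (hgd : ∀ ν, (g ν).IsHomogeneous d) {c : ι → MvPolynomial (Fin n) k} {μ : Fin n →₀ ℕ}
    (hc : ∀ ρ ∈ G, ρ.degree = d → μ ≺[m] ρ →
      ∑ ν, c ν * scaledCoeff T ρ (linearSubst A (g ν)) = 0)
    {ρ : Fin n →₀ ℕ} (hρ : μ ≺[m] ρ) :
    ∑ ν, c ν * scaledCoeff T ρ (linearSubst A (g ν)) = 0 := by
  classical
  set Q : (Fin n →₀ ℕ) → MvPolynomial (Fin n) k :=
    fun ρ => ∑ ν, c ν * scaledCoeff T ρ (linearSubst A (g ν)) with hQ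
  let B (t : Fin n → k) : Matrix (Fin n) (Fin n) k := A * Matrix.diagonal t * T
  let h (t : Fin n → k) : MvPolynomial (Fin n) k := ∑ ν, C (eval t (c ν)) * linearSubst (B t) (g ν)
  have hcoeff : ∀ t ρ, coeff ρ (h t) = eval t (Q ρ) := fun t ρ => by
    simp only [h, B, hQ, coeff_sum, map_sum, map_mul, coeff_C_mul, eval_scaledCoeff,
      linearSubst_linearSubst]
  have hhom : ∀ t, (h t).IsHomogeneous d := fun t =>
    IsHomogeneous.sum _ _ _ fun ν _ => (isHomogeneous_linearSubst _ (hgd ν)).C_mul _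
  have hdeg : ∀ ρ, Q ρ ≠ 0 → ρ.degree = d := fun ρ h0 => by
    obtain ⟨t, ht⟩ := exists_eval_ne_zero h0
    rw [Finsupp.degree_apply]
    exact ((hhom t).degree_eq_sum_deg_support
      (mem_support_iff.2 ((hcoeff t ρ).symm ▸ ht))).symm
  by_contra h0
  obtain ⟨ρ₀, hρ₀, hmax⟩ :=
    ((Finsupp.finite_of_degree_eq d).toFinset.filter fun ρ => Q ρ ≠ 0).exists_max_image m.toSyn
      ⟨ρ, by simpa using ⟨hdeg ρ h0, h0⟩⟩
  simp only [Finset.mem_filter, Set.Finite.mem_toFinset, Set.mem_ofPred_eq] at hρ₀ hmax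
  have hμρ₀ : μ ≺[m] ρ₀ := hρ.trans_le (hmax ρ ⟨hdeg ρ h0, h0⟩)
  let M : Matrix (Fin n) (Fin n) (MvPolynomial (Fin n) k) :=
    A.map C * Matrix.diagonal X * T.map C
  let q : MvPolynomial (Fin n) k := aeval (fun ij : Fin n × Fin n => M ij.1 ij.2) p
  have hMB : ∀ t, M.map (eval t) = B t := fun t => by
    simp only [M, B, Matrix.map_mul]
    congr 2
    · ext; simp
    · rw [Matrix.diagonal_map (map_zero _)]
      simp
    · ext; simp
  have hq : ∀ t, eval t q = eval (fun ij : Fin n × Fin n => B t ij.1 ij.2) p := fun t => by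
    rw [← hMB]
    exact eval_aeval_matrix p M t
  -- At `t = 1` the matrix is `A * T`, where `p` does not vanish.
  have hq0 : q ≠ 0 := fun hq0 => by
    have := hq 1
    rw [hq0, map_zero] at this
    refine hAT (this.symm ▸ ?_)
    simp [B]
  obtain ⟨t, ht⟩ := exists_eval_ne_zero (mul_ne_zero (mul_ne_zero hρ₀.2 hq0)
    (Finset.prod_ne_zero_iff.2 fun (l : Fin n) _ => X_ne_zero (R := k) l))
  simp only [map_mul, map_prod, eval_X] at ht
  have hB : (B t).det ≠ 0 := by
    simp only [B, Matrix.det_mul, Matrix.det_diagonal]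
    exact mul_ne_zero (mul_ne_zero hA (right_ne_zero_of_mul ht)) hT
  have hlead : coeff ρ₀ (h t) ≠ 0 :=
    (hcoeff t ρ₀).symm ▸ left_ne_zero_of_mul (left_ne_zero_of_mul ht)
  have hmem : ρ₀ ∈ G := by
    rw [← hp (B t) hB (hq t ▸ right_ne_zero_of_mul (left_ne_zero_of_mul ht))]
    refine ⟨h t, Ideal.sum_mem _ fun ν _ => Ideal.mul_mem_left _ _ ?_,
      fun h0 => hlead (by rw [h0, coeff_zero]), degree_eq_of_coeff hlead fun ρ' hρ' => ?_⟩
    · exact (mem_changeVars hB).2 ⟨_, hgI ν, rfl⟩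
    · rw [hcoeff]
      by_contra hne
      have hne' : Q ρ' ≠ 0 := fun h0 => hne (by rw [h0, map_zero])
      exact absurd (hmax ρ' ⟨hdeg ρ' hne', hne'⟩) (not_le.2 hρ')
  exact hρ₀.2 (hc ρ₀ hmem hρ₀.1 hμρ₀)

/-- The generic leading exponents are closed under the exchange of a variable, in its full
power, for a larger one. -/
lemma genericExps_exchange {I : Ideal (MvPolynomial (Fin n) k)}
    (hI : I.IsHomogeneous (homogeneousSubmodule (Fin n) k)) {i j : Fin n}
    (hij : Finsupp.single i 1 ≺[m] Finsupp.single j 1) {μ : Fin n →₀ ℕ}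
    (hμ : μ ∈ genericExps m I) :
    μ.erase i + Finsupp.single j (μ i) ∈ genericExps m I := by
  classical
  have hne : i ≠ j := by
    rintro rfl
    exact lt_irrefl _ hij
  obtain ⟨p, hp0, hp⟩ := forAlmostAll_leadExps_eq (m := m) hI
  set T : Matrix (Fin n) (Fin n) k := Matrix.transvection i j (-1) with hTdef
  have hT : T.det ≠ 0 := by
    rw [hTdef, Matrix.det_transvection_of_ne _ _ hne]
    exact one_ne_zero
  -- Non-vanishing of `p` is itself treated as a generic property, so that `A` and `A * T` can be
  -- made generic at once.
  have hp' : ForAlmostAll fun A : Matrix (Fin n) (Fin n) k =>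
      eval (fun ij : Fin n × Fin n => A ij.1 ij.2) p ≠ 0 := ⟨p, hp0, fun _ _ h => h⟩
  obtain ⟨A, hA, hpA, hpAT⟩ := (hp'.and (hp'.mul_right hT)).exists
  set G := genericExps m I
  set W : Finset (Fin n →₀ ℕ) := (Finsupp.finite_of_degree_eq μ.degree).toFinset.filter
    fun ρ => ρ ∈ G ∧ μ ≺[m] ρ
  have hW : ∀ {ρ}, ρ ∈ W ↔ ρ.degree = μ.degree ∧ ρ ∈ G ∧ μ ≺[m] ρ := by simp [W]
  have hμW : μ ∉ W := fun h => lt_irrefl _ (hW.1 h).2.2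
  set V := insert μ W with hVdef
  have hV : ∀ ν ∈ V, ν.degree = μ.degree ∧ ν ∈ G ∧ μ ≼[m] ν := fun ν hν => by
    rcases Finset.mem_insert.1 hν with rfl | hν
    · exact ⟨rfl, hμ, le_rfl⟩
    · exact ⟨(hW.1 hν).1, (hW.1 hν).2.1, (hW.1 hν).2.2.le⟩
  have hex : ∀ ν : V, ∃ g ∈ I, g.IsHomogeneous μ.degree ∧ linearSubst A g ≠ 0 ∧
      m.degree (linearSubst A g) = ν := fun ν => by
    rw [← (hV ν ν.2).1]
    exact exists_isHomogeneous_of_mem_leadExps hI hA ((hp A hA hpA).symm ▸ (hV ν ν.2).2.1)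
  choose g hgI hgd hg0 hgdeg using hex
  -- One unknown more than equations, since `V` is `W` together with `μ`.
  obtain ⟨c, hc0, hc⟩ := exists_ne_zero_mulVec_eq_zero (α := V) (β := W)
    (by simp [hVdef, Finset.card_insert_of_notMem hμW])
    (Matrix.of fun ρ ν => scaledCoeff T (ρ : Fin n →₀ ℕ) (linearSubst A (g ν)))
  have hQ : ∀ ρ, μ ≺[m] ρ → ∑ ν, c ν * scaledCoeff T ρ (linearSubst A (g ν)) = 0 := by
    refine fun ρ hρ => sum_mul_scaledCoeff_eq_zero hp hA hT hpAT hgI hgd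
      (fun ρ' h1 h2 h3 => ?_) hρ
    have := congrFun hc ⟨ρ', hW.2 ⟨h2, h1, h3⟩⟩
    simpa [Matrix.mulVec, dotProduct, mul_comm] using this
  obtain ⟨ν₀, hν₀⟩ := Function.ne_iff.1 hc0
  obtain ⟨ν₁, hν₁, hmax⟩ := (Finset.univ.filter fun ν => c ν ≠ 0).exists_max_image
    (fun ν => m.toSyn (m.degree (c ν) + ν)) ⟨ν₀, by simpa using hν₀⟩
  simp only [Finset.mem_filter, Finset.mem_univ, true_and] at hν₁ hmax
  -- The same term order serves for the scaling indeterminates; `τ` is the top exponent of `t` in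
  -- the combination, and `h` below is the coefficient of `t^τ` before `T` is applied.
  set τ := m.degree (c ν₁) + (ν₁ : Fin n →₀ ℕ) with hτ
  let β : V → k := fun ν =>
    coeff τ (c ν * monomial (ν : Fin n →₀ ℕ) 1) * m.leadingCoeff (linearSubst A (g ν))
  let h : MvPolynomial (Fin n) k := ∑ ν, C (β ν) * monomial (ν : Fin n →₀ ℕ) 1
  have hcoeffh : ∀ ρ (hρ : ρ ∈ V), coeff ρ h = β ⟨ρ, hρ⟩ := fun ρ hρ => by
    simp only [h, coeff_sum, coeff_C_mul, coeff_monomial]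
    rw [Finset.sum_eq_single ⟨ρ, hρ⟩]
    · simp
    · intro ν _ hν
      rw [if_neg fun h => hν (Subtype.ext h), mul_zero]
    · simp
  have hmemV : ∀ ρ, coeff ρ h ≠ 0 → ρ ∈ V := fun ρ hρ => by
    by_contra hn
    refine hρ ?_
    simp only [h, coeff_sum, coeff_C_mul, coeff_monomial]
    refine Finset.sum_eq_zero fun ν _ => ?_
    rw [if_neg fun he : (ν : Fin n →₀ ℕ) = ρ => hn (he ▸ ν.2), mul_zero]
  have hh0 : h ≠ 0 := fun h0 => by
    have h1 := hcoeffh ν₁ ν₁.2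
    rw [h0, coeff_zero] at h1
    refine mul_ne_zero ?_ (m.leadingCoeff_ne_zero_iff.2 (hg0 ν₁)) h1.symm
    rw [hτ, coeff_mul_monomial, mul_one]
    exact m.leadingCoeff_ne_zero_iff.2 hν₁
  have hTh : linearSubst T h = ∑ ν, C (β ν) * linearSubst T (monomial (ν : Fin n →₀ ℕ) 1) := by
    simp only [h, map_sum, map_mul, linearSubst_C]
  have hsupp : ∀ ρ, ρ ≠ μ → coeff ρ (linearSubst T h) = 0 := by
    intro ρ hρ
    by_cases hlt : μ ≺[m] ρ
    · have h1 := congrArg (coeff τ) (hQ ρ hlt)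
      rw [coeff_sum, coeff_zero] at h1
      rw [hTh, coeff_sum, ← h1]
      refine Finset.sum_congr rfl fun ν _ => ?_
      rw [coeff_C_mul, coeff_mul_scaledCoeff (m := m) fun h0 => (hgdeg ν).symm ▸ hmax ν h0,
        hgdeg]
    · rw [hTh, coeff_sum]
      refine Finset.sum_eq_zero fun ν _ => ?_
      rw [coeff_C_mul]
      by_contra h0
      have h1 := toSyn_le_of_mem_support_transvection hij.le (-1) ν ρ
        (mem_support_iff.2 (right_ne_zero_of_mul h0))
      have h2 := (hV ν ν.2).2.2
      exact hρ (m.toSyn.injective (le_antisymm (not_lt.1 hlt) (h2.trans h1)))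
  have hmon : linearSubst T h = monomial μ (coeff μ (linearSubst T h)) := by
    ext ρ
    rw [coeff_monomial]
    split_ifs with h1
    · rw [h1]
    · exact hsupp ρ (Ne.symm h1)
  have hinv : linearSubst (Matrix.transvection i j 1) (linearSubst T h) = h := by
    rw [linearSubst_linearSubst, hTdef, Matrix.transvection_mul_transvection_same _ _ hne,
      neg_add_cancel, Matrix.transvection_zero, linearSubst_one]
  -- Since `h` is supported in `V`, whose elements lie in `G`, a nonzero coefficient of `h` at the
  -- exchanged exponent is enough.
  refine (hV _ (hmemV _ ?_)).2.1
  rw [← hinv, hmon, coeff_transvection_monomial hne]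
  intro h0
  rw [h0, monomial_zero] at hmon
  exact hh0 (by rw [← hinv, hmon, map_zero])

end Exchange

/-! ### Uniqueness and lifting of the monomial Pommaret basis. -/

section DeltaRegular

variable {k : Type*} [Field k] {n : ℕ} {m : MonomialOrder (Fin n)}

lemma ForAlmostAll.eq_of_eq [Infinite k] {α : Type*} {F : Matrix (Fin n) (Fin n) k → α} {x y : α}
    (hx : ForAlmostAll fun A => F A = x) (hy : ForAlmostAll fun A => F A = y) : x = y :=
  let ⟨_, _, h1, h2⟩ := (hx.and hy).exists
  h1.symm.trans h2

lemma monomial_mem_of_isMonomialPommaretBasis {J : Ideal (MvPolynomial (Fin n) k)}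
    {H : Finset (Fin n →₀ ℕ)} (hH : IsMonomialPommaretBasis J H) {η : Fin n →₀ ℕ} (hη : η ∈ H) :
    monomial η (1 : k) ∈ J := by
  rw [hH.1]
  exact Ideal.subset_span ⟨η, hη, rfl⟩

/-- Each basis term of the leading ideal is the leading term, up to a scalar, of some homogeneous
element; one such choice per term is a Pommaret basis. -/
lemma isDeltaRegular_changeVars {I : Ideal (MvPolynomial (Fin n) k)}
    (hI : I.IsHomogeneous (homogeneousSubmodule (Fin n) k)) {A : Matrix (Fin n) (Fin n) k}
    (hA : A.det ≠ 0) (hqs : IsQuasiStable (leadingIdeal m (changeVars A I))) :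
    IsDeltaRegular m (changeVars A I) := by
  classical
  obtain ⟨H, hH⟩ := hqs
  have hex : ∀ η : H, ∃ g ∈ I, g.IsHomogeneous (η : Fin n →₀ ℕ).degree ∧ linearSubst A g ≠ 0 ∧
      m.degree (linearSubst A g) = η := fun η =>
    exists_isHomogeneous_of_mem_leadExps hI hA
      (mem_leadExps_of_monomial_mem (monomial_mem_of_isMonomialPommaretBasis hH η.2))
  choose g hgI hgd hg0 hgdeg using hex
  refine ⟨Finset.univ.image fun η => linearSubst A (g η), ?_, ?_, ?_⟩
  · intro f hf
    obtain ⟨η, -, rfl⟩ := Finset.mem_image.1 hf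
    exact ⟨(mem_changeVars hA).2 ⟨_, hgI η, rfl⟩, hg0 η, _, isHomogeneous_linearSubst A (hgd η)⟩
  · intro f hf f' hf' h
    obtain ⟨η, -, rfl⟩ := Finset.mem_image.1 hf
    obtain ⟨η', -, rfl⟩ := Finset.mem_image.1 hf'
    rw [hgdeg, hgdeg] at h
    rw [Subtype.ext h]
  · have : (Finset.univ.image fun η => linearSubst A (g η)).image m.degree = H := by
      ext η
      simp [hgdeg]
    rwa [this]

end DeltaRegular

end QuasiStable

end

theorem lemma4p1 {k : Type*} [Field k] [Infinite k] {n : ℕ} (m : MonomialOrder (Fin n))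
    (hm : ∀ i j : Fin n, i < j → Finsupp.single i 1 ≺[m] Finsupp.single j 1)
    (I : Ideal (MvPolynomial (Fin n) k))
    (hI : I.IsHomogeneous (MvPolynomial.homogeneousSubmodule (Fin n) k))
    (hI_bot : I ≠ ⊥) (hI_top : I ≠ ⊤) :
    (∃! J : Ideal (MvPolynomial (Fin n) k), QuasiStable.IsGenericInitialIdeal m I J) ∧
    (∀ J : Ideal (MvPolynomial (Fin n) k),
      QuasiStable.IsGenericInitialIdeal m I J → QuasiStable.IsQuasiStable J) ∧
    QuasiStable.ForAlmostAll (fun A : Matrix (Fin n) (Fin n) k =>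
      QuasiStable.IsDeltaRegular m (QuasiStable.changeVars A I)) := by
  set G := QuasiStable.genericExps m I
  have hgin : QuasiStable.IsGenericInitialIdeal m I
      (Ideal.span ((fun μ => monomial μ (1 : k)) '' G)) :=
    (QuasiStable.forAlmostAll_leadExps_eq hI).mono fun A _ hA => by
      rw [QuasiStable.leadingIdeal_eq_span_monomial, hA]
  have hqs : QuasiStable.IsQuasiStable (Ideal.span ((fun μ => monomial μ (1 : k)) '' G)) :=
    QuasiStable.isQuasiStable_of_exchange (QuasiStable.isUpperSet_leadExps _)
      fun μ hμ i j hij => QuasiStable.genericExps_exchange hI (hm i j hij) hμ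
  refine ⟨⟨_, hgin, fun J hJ => QuasiStable.ForAlmostAll.eq_of_eq hJ hgin⟩, fun J hJ => ?_, ?_⟩
  · rwa [QuasiStable.ForAlmostAll.eq_of_eq hJ hgin]
  · exact hgin.mono fun A hA h => QuasiStable.isDeltaRegular_changeVars hI hA (h.symm ▸ hqs)
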